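/- **Definitions.** Let $(X,d)$ be a metric space with base point $x_0$. For $x\in X$ put $b_x(y)=d(x,y)-d(x,x_0)$, and let $\partial(X,d)$ be the set of all functions $X\to\mathbb R$ that lie in the closure of $\{b_x : x\in X\}$ for the topology of pointwise convergence but are not themselves of the form $b_x$; its elements are called *metric-functionals*. On a group the base point is the identity, and $G$ acts on functions $h:G\to\mathbb R$ with $h(1)=0$ by $(x.h)(y)=h(x^{-1}y)-h(x^{-1})$. A *Banach metric* on a finitely generated infinite group $G$ is a metric $d$ on $G$ such that: (1) $d(x,y)\in\mathbb N$ for all $x,y$; (2) $d(zx,zy)=d(x,y)$ for all $x,y,z$; (3) every ball $\{x : d(x,1)\le r\}$, $r>0$, is finite; (4) $(G,d)$ is quasi-isometric to a Cayley graph of $G$ with respect to a finite symmetric generating set; (5) every $h\in\partial(G,d)$ is an unbounded function. (A finite group has no Banach metric.) A *virtual homomorphism* on a group $G$ is a function $\varphi:G\to\mathbb Z$ whose restriction to some subgroup of finite index is a non-trivial homomorphism. **Theorem.** Let $G$ be a finitely generated group. The following are equivalent: * $G$ admits some virtual homomorphism. * There exist a Banach metric $d$ on $G$ and some $h\in\partial(G,d)$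 with finite orbit, $|G.h|<\infty$. Moreover, if $G$ admits a surjective homomorphism onto $\mathbb Z$, then there exist a Banach metric $d$ on $G$ and some $h\in\partial(G,d)$ that is a fixed point of $G$, i.e. $x.h=h$ for all $x\in G$. -/

import Mathlib

open Set Topology

namespace BanachMetrics

/-- The set `L(X,d)` of all real functions on `X` that are `1`-Lipschitz for `d` and vanish at the
base point. -/
def lipSpace {X : Type*} (d : MetricSpace X) (x₀ : X) : Set (X → ℝ) :=
  {h | (∀ x y, |h x - h y| ≤ d.dist x y) ∧ h x₀ = 0}

/-- The Busemann function `b_x(y) = d(x,y) - d(x,x₀)`. -/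
def busemann {X : Type*} (d : MetricSpace X) (x₀ x : X) : X → ℝ :=
  fun y => d.dist x y - d.dist x x₀

theorem busemann_mem_lipSpace {X : Type*} (d : MetricSpace X) (x₀ x : X) :
    busemann d x₀ x ∈ lipSpace d x₀ := by
  refine ⟨fun y z => ?_, sub_self _⟩
  have h := @abs_dist_sub_le X d.toPseudoMetricSpace y z x
  rw [@dist_comm X d.toPseudoMetricSpace y x, @dist_comm X d.toPseudoMetricSpace z x] at h
  simpa [busemann] using h

theorem isClosed_lipSpace {X : Type*} (d : MetricSpace X) (x₀ : X) :
    IsClosed (lipSpace d x₀) := by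
  have h : lipSpace d x₀ =
      (⋂ x, ⋂ y, {h : X → ℝ | |h x - h y| ≤ d.dist x y}) ∩ {h | h x₀ = 0} := by
    ext h
    simp [lipSpace]
  rw [h]
  refine IsClosed.inter (isClosed_iInter fun x => isClosed_iInter fun y => ?_) ?_
  · exact isClosed_le (by fun_prop) continuous_const
  · exact isClosed_eq (by fun_prop) continuous_const

/-- The closure of the set of Busemann functions. It is taken in `X → ℝ` with the product topology,
that is, the topology of pointwise convergence; since `lipSpace d x₀` is closed and contains all
Busemann functions, this is the same as the closure inside `lipSpace d x₀`
(see `compactification_subset_lipSpace`). -/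
def compactification {X : Type*} (d : MetricSpace X) (x₀ : X) : Set (X → ℝ) :=
  closure (Set.range (busemann d x₀))

theorem compactification_subset_lipSpace {X : Type*} (d : MetricSpace X) (x₀ : X) :
    compactification d x₀ ⊆ lipSpace d x₀ :=
  closure_minimal (Set.range_subset_iff.2 (busemann_mem_lipSpace d x₀)) (isClosed_lipSpace d x₀)

/-- The metric-functional boundary: limits of Busemann functions that are not themselves Busemann
functions. Its elements are the metric-functionals. -/
def boundary {X : Type*} (d : MetricSpace X) (x₀ : X) : Set (X → ℝ) :=
  compactification d x₀ \ Set.range (busemann d x₀)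

/-- The action of a group on functions: `(x.h)(y) = h(x⁻¹ y) - h(x⁻¹)`. -/
def translate {G : Type*} [Group G] (x : G) (h : G → ℝ) : G → ℝ :=
  fun y => h (x⁻¹ * y) - h x⁻¹

/-- The orbit `G.h`. -/
def functionalOrbit {G : Type*} [Group G] (h : G → ℝ) : Set (G → ℝ) :=
  Set.range fun x : G => translate x h

/-- `S` is a finite symmetric generating set of `G`. -/
structure IsFiniteSymmGenSet {G : Type*} [Group G] (S : Set G) : Prop where
  finite : S.Finite
  symm : ∀ s ∈ S, s⁻¹ ∈ S
  generates : Subgroup.closure S = ⊤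

/-- The graph distance of the Cayley graph in which `x ∼ y` if and only if `x⁻¹ y ∈ S`. -/
noncomputable def cayleyDist {G : Type*} [Group G] (S : Set G) (x y : G) : ℝ :=
  ((SimpleGraph.mulCayley S).dist x y : ℝ)

/-- Two distance functions are quasi-isometric. -/
def QuasiIsometric {X Y : Type*} (dX : X → X → ℝ) (dY : Y → Y → ℝ) : Prop :=
  ∃ φ : X → Y, ∃ C : ℝ, 0 < C ∧
    (∀ y, ∃ x, dY (φ x) y ≤ C) ∧
    ∀ x x', C⁻¹ * dX x x' - C ≤ dY (φ x) (φ x') ∧ dY (φ x) (φ x') ≤ C * dX x x' + C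

/-- A Banach metric on an infinite (finitely generated) group; the base point is the identity.
Finite generation follows from the field `quasiIsometric`. -/
structure IsBanachMetric {G : Type*} [Group G] (d : MetricSpace G) : Prop where
  infinite : Infinite G
  integer_valued : ∀ x y : G, ∃ n : ℕ, d.dist x y = n
  left_invariant : ∀ x y z : G, d.dist (z * x) (z * y) = d.dist x y
  proper : ∀ r : ℝ, 0 < r → {x : G | d.dist x 1 ≤ r}.Finite
  quasiIsometric : ∃ S : Set G, IsFiniteSymmGenSet S ∧ QuasiIsometric d.dist (cayleyDist S)
  unbounded : ∀ h ∈ boundary d (1 : G), ¬ ∃ C : ℝ, ∀ x, |h x| ≤ C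

/-- A function `φ : G → ℤ` is a virtual homomorphism if its restriction to some subgroup of finite
index is a non-trivial homomorphism. -/
def IsVirtualHom {G : Type*} [Group G] (φ : G → ℤ) : Prop :=
  ∃ H : Subgroup G, H.FiniteIndex ∧
    (∀ x ∈ H, ∀ y ∈ H, φ (x * y) = φ x + φ y) ∧ ∃ x ∈ H, φ x ≠ 0

end BanachMetrics

/-!
Suppose first that a metric-functional `h` of a Banach metric has finite orbit. Its stabilizer has
finite index, and invariance of `h` says exactly that `h` is additive there. Since `h` takes integer
values, it is a virtual homomorphism unless it vanishes on the stabilizer; but then `h` would take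
only one value on each of finitely many cosets, whereas metric-functionals of a Banach metric are
unbounded (`exists_isVirtualHom`).

Conversely, restrict a virtual homomorphism to a normal subgroup `N` of finite index and extend it
`N`-equivariantly to `G`. The `G`-orbit of the extension and its negative form a finite invariant
family `F` of functions `G → ℤ` whose members are non-trivial homomorphisms on `N`
(`exists_isCharFamily`). For a finite symmetric generating set `S`, put
`d(x,y) = max(d_S(x,y), max_{f ∈ F} (f x - f y))`, where `d_S` is the word metric. Invariance of `F`
makes `d` a left-invariant metric, bi-Lipschitz to `d_S`. Its metric-functionals are unbounded
(`IsCharFamily.exists_le_abs_busemann`): far from `1`, either some `f x` is comparable to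
`d(x,1)`, and `d(x,y)` is large where `f y` is very negative, or `d(x,y) = d_S(x,y)` for `y` near `1`, and
then `y ↦ d(x,y) - d(x,1)` decreases at rate `1` along a word geodesic from `1` to `x`.

Finally take `t ∈ N` so generic that members of `F` with the same value at `t` agree on `N`; this is
possible because a group is not a finite union of cosets of subgroups of infinite index
(`IsCharFamily.exists_generic`). Choose `S` to contain `t`, and `t` to be a square, so that the
largest `f t` is at least `2`. Then the word metric, which grows at rate at most `1` along `t ^ n`,
does not contribute to `d(t ^ n, y)` for large `n`, and the Busemann functions of `t ^ n` converge to
`h(y) = - min f(y)`, over those `f` for which `f t` is maximal. All these `f` agree on `N`, so `N`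
shifts `h` by constants, that is, fixes it (`IsCharFamily.exists_mem_boundary`); hence the orbit of
`h` is finite. When `G` maps onto `ℤ` one may take `N = G`.
-/

open Set Topology

namespace BanachMetrics

variable {G : Type*} [Group G]

/-! ### Cayley graphs -/

section Cayley

variable {S : Set G}

theorem IsFiniteSymmGenSet.connected (hS : IsFiniteSymmGenSet S) :
    (SimpleGraph.mulCayley S).Connected := by
  have key : ∀ g : G, ∀ a : G, (SimpleGraph.mulCayley S).Reachable a (a * g) := by
    intro g
    have hg : g ∈ Subgroup.closure S := by rw [hS.generates]; trivial
    induction hg using Subgroup.closure_induction with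
    | mem s hs =>
      intro a
      by_cases h : a = a * s
      · rw [← h]
      · exact SimpleGraph.Adj.reachable ((SimpleGraph.mulCayley_adj S _ _).2 ⟨h, Or.inl (by simpa)⟩)
    | one => intro a; simp
    | mul x y _ _ hx hy => intro a; rw [← mul_assoc]; exact (hx a).trans (hy _)
    | inv x _ hx => intro a; simpa using (hx (a * x⁻¹)).symm
  refine (SimpleGraph.connected_iff _).2 ⟨fun x y => ?_, ⟨1⟩⟩
  simpa using key (x⁻¹ * y) x

/-- A walk of length `dist x y` passes at time `k` through a point dividing it. -/
theorem _root_.SimpleGraph.Connected.exists_dist_le_and_dist_le {V : Type*} {Γ : SimpleGraph V}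
    (hΓ : Γ.Connected) (x y : V) (k : ℕ) :
    ∃ z, Γ.dist x z ≤ k ∧ Γ.dist z y ≤ Γ.dist x y - k := by
  obtain ⟨p, hp⟩ := hΓ.exists_walk_length_eq_dist x y
  refine ⟨p.getVert k, (SimpleGraph.dist_le (p.take k)).trans ?_,
    (SimpleGraph.dist_le (p.drop k)).trans ?_⟩
  · simp
  · simp [hp]

theorem dist_mulCayley_mul_left (z x y : G) :
    (SimpleGraph.mulCayley S).dist (z * x) (z * y) = (SimpleGraph.mulCayley S).dist x y := by
  let e : SimpleGraph.mulCayley S ≃g SimpleGraph.mulCayley S :=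
    ⟨Equiv.mulLeft z, by simp⟩
  have : (SimpleGraph.mulCayley S).edist (e x) (e y) = (SimpleGraph.mulCayley S).edist x y := by
    apply le_antisymm
    · refine le_iInf fun p => ?_
      simpa using SimpleGraph.edist_le (p.map e.toHom)
    · refine le_iInf fun p => ?_
      simpa using SimpleGraph.edist_le ((p.map e.symm.toHom).copy
        (e.symm_apply_apply x) (e.symm_apply_apply y))
  exact congrArg ENat.toNat this

theorem IsFiniteSymmGenSet.finite_ball (hS : IsFiniteSymmGenSet S) (n : ℕ) :
    {x : G | (SimpleGraph.mulCayley S).dist x 1 ≤ n}.Finite := by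
  induction n with
  | zero =>
    refine (Set.finite_singleton (1 : G)).subset fun x hx => ?_
    exact hS.connected.dist_eq_zero_iff.1 (Nat.le_zero.1 hx)
  | succ n ih =>
    refine (ih.union (ih.image2 (fun z s => z * s) hS.finite)).subset fun y hy => ?_
    obtain ⟨z, hz, hzy⟩ := hS.connected.exists_dist_le_and_dist_le 1 y n
    rw [SimpleGraph.dist_comm] at hz
    have hy' : (SimpleGraph.mulCayley S).dist 1 y ≤ n + 1 := by
      rw [SimpleGraph.dist_comm]; exact hy
    have h1 : (SimpleGraph.mulCayley S).dist z y ≤ 1 := by omega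
    rcases Nat.le_one_iff_eq_zero_or_eq_one.1 h1 with h | h
    · left
      rw [hS.connected.dist_eq_zero_iff] at h
      exact h ▸ hz
    · right
      obtain ⟨-, h | h⟩ := (SimpleGraph.mulCayley_adj S _ _).1 (SimpleGraph.dist_eq_one_iff_adj.1 h)
      · exact ⟨z, hz, _, h, by simp⟩
      · exact ⟨z, hz, _, hS.symm _ h, by simp⟩

end Cayley

/-! ### Unboundedness of metric-functionals -/

/-- If `h` is a metric-functional, then it is a limit of Busemann functions of points outside any
given finite set, so that it is approximated on finite sets by such Busemann functions. -/
theorem exists_busemann_near {X : Type*} {d : MetricSpace X} {x₀ : X} {h : X → ℝ}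
    (hh : h ∈ boundary d x₀) {A B : Set X} (hA : A.Finite) (hB : B.Finite) :
    ∃ x ∉ B, ∀ y ∈ A, |busemann d x₀ x y - h y| < 1 := by
  have h1 : h ∈ closure (busemann d x₀ '' Bᶜ) := by
    have h2 : h ∈ closure (busemann d x₀ '' B ∪ busemann d x₀ '' Bᶜ) := by
      rw [← Set.image_union, Set.union_compl_self, Set.image_univ]
      exact hh.1
    rw [closure_union, (hB.image _).isClosed.closure_eq] at h2
    exact h2.resolve_left fun h3 => hh.2 (Set.image_subset_range _ _ h3)
  have hU : IsOpen (⋂ y ∈ A, {g : X → ℝ | |g y - h y| < 1}) :=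
    hA.isOpen_biInter fun y _ => isOpen_lt (by fun_prop) continuous_const
  obtain ⟨_, hg, x, hx, rfl⟩ := mem_closure_iff.1 h1 _ hU (by simp)
  exact ⟨x, hx, fun y hy => by simpa using Set.mem_iInter₂.1 hg y hy⟩

theorem not_bounded_of_mem_boundary {X : Type*} {d : MetricSpace X} {x₀ : X}
    (hd : ∀ C : ℕ, ∃ A B : Set X, A.Finite ∧ B.Finite ∧
      ∀ x ∉ B, ∃ y ∈ A, (C : ℝ) ≤ |busemann d x₀ x y|)
    {h : X → ℝ} (hh : h ∈ boundary d x₀) : ¬ ∃ C : ℝ, ∀ x, |h x| ≤ C := by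
  rintro ⟨C, hC⟩
  obtain ⟨m, hm⟩ := exists_nat_ge (C + 1)
  obtain ⟨A, B, hA, hB, hAB⟩ := hd m
  obtain ⟨x, hx, hxA⟩ := exists_busemann_near hh hA hB
  obtain ⟨y, hy, hxy⟩ := hAB x hx
  have h1 := hxA y hy
  have h2 := abs_sub_abs_le_abs_sub (busemann d x₀ x y) (h y)
  linarith [hC y]

/-! ### Functionals with finite orbit give virtual homomorphisms -/

theorem boundary_int_valued {d : MetricSpace G} (hd : IsBanachMetric d) {h : G → ℝ}
    (hh : h ∈ boundary d (1 : G)) (y : G) : ∃ m : ℤ, h y = m := by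
  have hcl : IsClosed {g : G → ℝ | g y ∈ Set.range ((↑) : ℤ → ℝ)} :=
    Int.isClosedEmbedding_coe_real.isClosed_range.preimage (continuous_apply y)
  have hsub : compactification d (1 : G) ⊆ {g : G → ℝ | g y ∈ Set.range ((↑) : ℤ → ℝ)} := by
    refine closure_minimal ?_ hcl
    rintro _ ⟨x, rfl⟩
    obtain ⟨a, ha⟩ := hd.integer_valued x y
    obtain ⟨b, hb⟩ := hd.integer_valued x 1
    exact ⟨(a : ℤ) - b, by simp [busemann, ha, hb]⟩
  obtain ⟨m, hm⟩ := hsub hh.1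
  exact ⟨m, hm.symm⟩

theorem finite_range_of_mul_right {α : Type*} {N : Subgroup G} [N.FiniteIndex] {T : G → α}
    (hT : ∀ x, ∀ n ∈ N, T (x * n) = T x) : (Set.range T).Finite := by
  refine (Set.finite_range fun q : G ⧸ N => T q.out).subset ?_
  rintro _ ⟨x, rfl⟩
  refine ⟨(x : G ⧸ N), ?_⟩
  have := QuotientGroup.eq.1 (QuotientGroup.out_eq' (x : G ⧸ N)).symm
  simpa using hT x _ this

/-- The stabilizer of `h` under `translate`. The carrier is defined by the equation
`x⁻¹.h = h`, which shows that `h` restricts to a homomorphism. -/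
def translateStabilizer (h : G → ℝ) (h1 : h 1 = 0) : Subgroup G where
  carrier := {x | ∀ y, h (x * y) = h x + h y}
  one_mem' := by simp [h1]
  mul_mem' := by
    intro a b ha hb y
    rw [mul_assoc, ha, hb, ha b, add_assoc]
  inv_mem' := by
    intro a ha y
    have e1 := ha (a⁻¹ * y)
    have e2 := ha a⁻¹
    simp only [mul_inv_cancel_left, mul_inv_cancel, h1] at e1 e2
    linarith

theorem finiteIndex_translateStabilizer {h : G → ℝ} (h1 : h 1 = 0)
    (hf : (functionalOrbit h).Finite) : (translateStabilizer h h1).FiniteIndex := by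
  have : Finite (functionalOrbit h) := hf
  have hinj : ∀ a b : G, translate a h = translate b h → a⁻¹ * b ∈ translateStabilizer h h1 := by
    intro a b hab y
    have e1 := congrFun hab (b * y)
    have e2 := congrFun hab b
    simp only [translate, inv_mul_cancel, one_mul, h1, ← mul_assoc] at e1 e2
    linarith
  have hfin : Finite (G ⧸ translateStabilizer h h1) := by
    refine Finite.of_injective
      (fun q : G ⧸ translateStabilizer h h1 => (⟨translate q.out h, q.out, rfl⟩ : functionalOrbit h))
      fun p q hpq => ?_
    have := hinj _ _ (congrArg Subtype.val hpq)
    rw [← QuotientGroup.eq] at this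
    simpa using this
  exact Subgroup.finiteIndex_of_finite_quotient

theorem exists_isVirtualHom {d : MetricSpace G} (hd : IsBanachMetric d) {h : G → ℝ}
    (hh : h ∈ boundary d (1 : G)) (hf : (functionalOrbit h).Finite) :
    ∃ φ : G → ℤ, IsVirtualHom φ := by
  have h1 : h 1 = 0 := (compactification_subset_lipSpace d 1 hh.1).2
  choose φ hφ using boundary_int_valued hd hh
  have hfi := finiteIndex_translateStabilizer h1 hf
  refine ⟨φ, translateStabilizer h h1, hfi, fun x hx y _ => ?_, ?_⟩
  · have := hx y
    rw [hφ, hφ, hφ] at this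
    exact_mod_cast this
  · by_contra! hzero
    have hinv : ∀ x ∈ translateStabilizer h h1, ∀ y, h (x * y) = h y := by
      intro x hx y
      rw [hx y, hφ x, hzero x hx]
      simp
    -- `h` is constant on the right cosets of its stabilizer, so it has finitely many values.
    have hfin : (Set.range h).Finite := by
      have h2 : (Set.range fun y => h y⁻¹).Finite :=
        finite_range_of_mul_right (N := translateStabilizer h h1) fun x n hn => by
          rw [mul_inv_rev, hinv _ (inv_mem hn)]
      refine h2.subset ?_
      rintro _ ⟨y, rfl⟩
      exact ⟨y⁻¹, by simp⟩
    obtain ⟨C, hC⟩ := (hfin.image abs).bddAbove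
    exact hd.unbounded h hh ⟨C, fun x => hC ⟨_, ⟨x, rfl⟩, rfl⟩⟩

/-! ### Finite invariant families of virtual characters -/

/-- A nonempty finite family of functions `G → ℤ` that are non-trivial homomorphisms on `N`,
equivariant under left multiplication by `N`, stable under negation and under the action
`(x.f)(y) = f(x⁻¹y) - f(x⁻¹)` of `G`. -/
structure IsCharFamily (N : Subgroup G) (F : Finset (G → ℤ)) : Prop where
  map_mul : ∀ f ∈ F, ∀ n ∈ N, ∀ y, f (n * y) = f n + f y
  translate_mem : ∀ f ∈ F, ∀ x : G, (fun y => f (x⁻¹ * y) - f x⁻¹) ∈ F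
  neg_mem : ∀ f ∈ F, -f ∈ F
  ne_zero : ∀ f ∈ F, ∃ n ∈ N, f n ≠ 0
  nonempty : F.Nonempty

/-- Extend `φ` from `N` to `G` equivariantly by means of a transversal, and take the orbit of
this extension and its negative. -/
theorem exists_isCharFamily {N : Subgroup G} [N.Normal] [N.FiniteIndex] {φ : G → ℤ}
    (hφ : ∀ x ∈ N, ∀ y ∈ N, φ (x * y) = φ x + φ y) (hne : ∃ x ∈ N, φ x ≠ 0) :
    ∃ F : Finset (G → ℤ), IsCharFamily N F := by
  classical
  obtain ⟨a, ha, ha0⟩ := hne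
  let r : G → G := fun y => (y : G ⧸ N).out
  have hr : ∀ y, y * (r y)⁻¹ ∈ N := fun y => by
    have := QuotientGroup.eq.1 (QuotientGroup.out_eq' (y : G ⧸ N))
    exact (‹N.Normal›.mem_comm_iff).1 this
  have hrn : ∀ n ∈ N, ∀ y, r (n * y) = r y := fun n hn y => by
    have : ((n * y : G) : G ⧸ N) = y := by
      rw [QuotientGroup.mk_mul, (QuotientGroup.eq_one_iff n).2 hn, one_mul]
    simp only [r, this]
  let w : G → ℤ := fun y => φ (y * (r y)⁻¹)
  have hw : ∀ n ∈ N, ∀ y, w (n * y) = φ n + w y := fun n hn y => by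
    simp only [w, hrn n hn, mul_assoc]
    exact hφ n hn _ (hr y)
  let T : G → G → ℤ := fun x y => w (x⁻¹ * y) - w x⁻¹
  have hconj : ∀ x, ∀ n ∈ N, x⁻¹ * n * x ∈ N := fun x n hn => by
    simpa using ‹N.Normal›.conj_mem n hn x⁻¹
  have hTN : ∀ x, ∀ n ∈ N, ∀ y, T x (n * y) = φ (x⁻¹ * n * x) + T x y := fun x n hn y => by
    have := hw _ (hconj x n hn) (x⁻¹ * y)
    simp only [T]
    rw [show x⁻¹ * (n * y) = x⁻¹ * n * x * (x⁻¹ * y) by group, this]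
    ring
  have hT1 : ∀ x, T x 1 = 0 := fun x => by simp [T]
  have hTn : ∀ x, ∀ n ∈ N, T x n = φ (x⁻¹ * n * x) := fun x n hn => by
    simpa [hT1] using hTN x n hn 1
  have hTT : ∀ x z, (fun y => T x (z⁻¹ * y) - T x z⁻¹) = T (z * x) := fun x z => by
    funext y
    simp only [T, mul_inv_rev, mul_assoc]
    ring
  have hTcoset : ∀ x, ∀ n ∈ N, T (x * n) = T x := fun x n hn => by
    funext y
    simp only [T, mul_inv_rev, mul_assoc, hw _ (inv_mem hn)]
    ring
  have hfin : (Set.range T).Finite := finite_range_of_mul_right hTcoset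
  have hmem : ∀ f, f ∈ hfin.toFinset ∪ hfin.toFinset.image (fun g => -g) ↔
      ∃ x, T x = f ∨ -T x = f := by
    simp [exists_or]
  refine ⟨hfin.toFinset ∪ hfin.toFinset.image (fun g => -g), ?_, ?_, ?_, ?_, ?_⟩
  · intro f hf n hn y
    obtain ⟨x, rfl | rfl⟩ := (hmem f).1 hf
    · rw [hTN x n hn, hTn x n hn]
    · simp only [Pi.neg_apply, hTN x n hn y, hTn x n hn]
      ring
  · intro f hf z
    obtain ⟨x, rfl | rfl⟩ := (hmem f).1 hf
    · exact (hmem _).2 ⟨z * x, Or.inl (hTT x z).symm⟩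
    · refine (hmem _).2 ⟨z * x, Or.inr ?_⟩
      rw [← hTT]
      funext y
      simp only [Pi.neg_apply]
      ring
  · intro f hf
    obtain ⟨x, rfl | rfl⟩ := (hmem f).1 hf
    · exact (hmem _).2 ⟨x, Or.inr rfl⟩
    · exact (hmem _).2 ⟨x, Or.inl (by simp)⟩
  · intro f hf
    obtain ⟨x, hx⟩ := (hmem f).1 hf
    refine ⟨x * a * x⁻¹, ‹N.Normal›.conj_mem a ha x, ?_⟩
    have h2 : T x (x * a * x⁻¹) = φ a := by
      rw [hTn x _ (‹N.Normal›.conj_mem a ha x)]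
      congr 1
      group
    obtain rfl | rfl := hx
    · rwa [h2]
    · simpa [h2] using ha0
  · exact ⟨T 1, (hmem _).2 ⟨1, Or.inl rfl⟩⟩

open scoped Pointwise in
/-- Finitely many non-trivial homomorphisms to `ℤ` are simultaneously non-trivial at some element:
their kernels have infinite index, so by B. H. Neumann's lemma they do not cover the group. -/
theorem exists_forall_hom_ne_one {Γ ι : Type*} [Group Γ] (s : Finset ι)
    (ψ : ι → Γ →* Multiplicative ℤ) (hψ : ∀ i ∈ s, ψ i ≠ 1) : ∃ x, ∀ i ∈ s, ψ i x ≠ 1 := by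
  by_contra! hcon
  have hcov : ⋃ i ∈ s, (1 : Γ) • ((ψ i).ker : Set Γ) = Set.univ := by
    refine Set.eq_univ_of_forall fun x => ?_
    obtain ⟨i, hi, hx⟩ := hcon x
    exact Set.mem_iUnion₂.2 ⟨i, hi, by simpa using hx⟩
  obtain ⟨i, hi, hfi⟩ := Subgroup.exists_finiteIndex_of_leftCoset_cover (g := fun _ => 1) hcov
  refine hψ i hi (MonoidHom.ext fun x => ?_)
  obtain ⟨n, hn, -, hx⟩ := Subgroup.exists_pow_mem_of_index_ne_zero hfi.index_ne_zero x
  rw [MonoidHom.mem_ker, map_pow] at hx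
  simpa using (pow_eq_one_iff.1 hx).resolve_right hn.ne'

namespace IsCharFamily

variable {N : Subgroup G} {F : Finset (G → ℤ)}

theorem map_one (hF : IsCharFamily N F) {f : G → ℤ} (hf : f ∈ F) : f 1 = 0 := by
  have := hF.map_mul f hf 1 N.one_mem 1
  simpa using this

theorem map_pow (hF : IsCharFamily N F) {f : G → ℤ} (hf : f ∈ F) {x : G} (hx : x ∈ N) (k : ℕ) :
    f (x ^ k) = k * f x := by
  induction k with
  | zero => simp [hF.map_one hf]
  | succ k ih =>
    rw [pow_succ', hF.map_mul f hf x hx, ih]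
    push_cast
    ring

theorem exists_lt (hF : IsCharFamily N F) {f : G → ℤ} (hf : f ∈ F) (K : ℤ) : ∃ y, f y ≤ K := by
  obtain ⟨n, hn, h0⟩ := hF.ne_zero f hf
  have hinv : f n⁻¹ = - f n := by
    have := hF.map_mul f hf n hn n⁻¹
    rw [mul_inv_cancel, hF.map_one hf] at this
    linarith
  rcases lt_or_gt_of_ne h0 with h | h
  · refine ⟨n ^ K.natAbs, ?_⟩
    rw [hF.map_pow hf hn]
    have : -K ≤ (K.natAbs : ℤ) := by omega
    nlinarith
  · refine ⟨n⁻¹ ^ K.natAbs, ?_⟩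
    rw [hF.map_pow hf (inv_mem hn), hinv]
    have : -K ≤ (K.natAbs : ℤ) := by omega
    nlinarith

/-- A generic element of `N`: members of `F` that agree at `t` agree on `N`, and the values at `t`
have maximum at least `2`. -/
theorem exists_generic (hF : IsCharFamily N F) :
    ∃ t ∈ N, (∀ f ∈ F, ∀ g ∈ F, f t = g t → ∀ n ∈ N, f n = g n) ∧ ∃ f ∈ F, 2 ≤ f t := by
  classical
  let ψ : F → N →* Multiplicative ℤ := fun f =>
    { toFun := fun n => Multiplicative.ofAdd (f.1 n)
      map_one' := by simp [hF.map_one f.2]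
      map_mul' := fun m n => by
        rw [← ofAdd_add, ← hF.map_mul f.1 f.2 m m.2 n]
        rfl }
  obtain ⟨x, hx⟩ := exists_forall_hom_ne_one
    ((Finset.univ : Finset (F × F)).filter fun p => ψ p.1 / ψ p.2 ≠ 1)
    (fun p => ψ p.1 / ψ p.2) (by simp)
  have hgen : ∀ f ∈ F, ∀ g ∈ F, f x = g x → ∀ n ∈ N, f n = g n := by
    intro f hf g hg hfg n hn
    have h1 : ψ ⟨f, hf⟩ / ψ ⟨g, hg⟩ = 1 := by
      by_contra hne
      refine hx (⟨f, hf⟩, ⟨g, hg⟩) (by simpa using hne) ?_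
      simp [ψ, hfg]
    have h2 := DFunLike.congr_fun h1 ⟨n, hn⟩
    have h3 : Multiplicative.ofAdd (f n) = Multiplicative.ofAdd (g n) := by
      simpa [ψ, div_eq_one] using h2
    exact Multiplicative.ofAdd.injective h3
  obtain ⟨f, hf⟩ := hF.nonempty
  have hf0 : f x ≠ 0 := by
    intro h0
    obtain ⟨n, hn, hne⟩ := hF.ne_zero f hf
    have := hgen f hf (-f) (hF.neg_mem f hf) (by simp [h0]) n hn
    simp only [Pi.neg_apply] at this
    omega
  refine ⟨x ^ 2, pow_mem x.2 2, ?_, ?_⟩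
  · intro f hf g hg hfg
    rw [hF.map_pow hf x.2, hF.map_pow hg x.2] at hfg
    exact hgen f hf g hg (by push_cast at hfg; linarith)
  · rcases lt_or_gt_of_ne hf0 with h | h
    · refine ⟨-f, hF.neg_mem f hf, ?_⟩
      rw [Pi.neg_apply, hF.map_pow hf x.2]
      push_cast
      linarith
    · refine ⟨f, hf, ?_⟩
      rw [hF.map_pow hf x.2]
      push_cast
      linarith

end IsCharFamily

/-! ### The metric of an invariant family -/

/-- The maximum of the word metric of `S` and of the differences `f x - f y`, for `f` in `F`. -/
noncomputable def charNatDist (S : Set G) (F : Finset (G → ℤ)) (x y : G) : ℕ :=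
  max ((SimpleGraph.mulCayley S).dist x y) (F.sup fun f => (f x - f y).toNat)

theorem charNatDist_le_iff {S : Set G} {F : Finset (G → ℤ)} {x y : G} {n : ℕ} :
    charNatDist S F x y ≤ n ↔
      (SimpleGraph.mulCayley S).dist x y ≤ n ∧ ∀ f ∈ F, f x - f y ≤ n := by
  simp [charNatDist, Int.toNat_le]

theorem dist_le_charNatDist (S : Set G) (F : Finset (G → ℤ)) (x y : G) :
    (SimpleGraph.mulCayley S).dist x y ≤ charNatDist S F x y :=
  (charNatDist_le_iff.1 le_rfl).1

theorem sub_le_charNatDist (S : Set G) {F : Finset (G → ℤ)} {f : G → ℤ} (hf : f ∈ F) (x y : G) :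
    f x - f y ≤ charNatDist S F x y :=
  (charNatDist_le_iff.1 le_rfl).2 f hf

namespace IsCharFamily

variable {N : Subgroup G} {F : Finset (G → ℤ)} {S : Set G}

theorem charNatDist_comm (hF : IsCharFamily N F) (x y : G) :
    charNatDist S F x y = charNatDist S F y x := by
  have key : ∀ x y, charNatDist S F x y ≤ charNatDist S F y x := fun x y => by
    refine charNatDist_le_iff.2 ⟨?_, fun f hf => ?_⟩
    · rw [SimpleGraph.dist_comm]
      exact dist_le_charNatDist S F y x
    · have := sub_le_charNatDist S (hF.neg_mem f hf) y x
      simp only [Pi.neg_apply] at this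
      linarith
  exact le_antisymm (key x y) (key y x)

theorem charNatDist_mul_left (hF : IsCharFamily N F) (z x y : G) :
    charNatDist S F (z * x) (z * y) = charNatDist S F x y := by
  have key : ∀ z x y, charNatDist S F (z * x) (z * y) ≤ charNatDist S F x y := fun z x y => by
    refine charNatDist_le_iff.2 ⟨?_, fun f hf => ?_⟩
    · rw [dist_mulCayley_mul_left]
      exact dist_le_charNatDist S F x y
    · have := sub_le_charNatDist S (hF.translate_mem f hf z⁻¹) x y
      simp only [inv_inv] at this
      linarith
  refine le_antisymm (key z x y) ?_
  simpa using key z⁻¹ (z * x) (z * y)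

/-- The left-invariant metric with distance `charNatDist S F`. -/
@[reducible] noncomputable def metric (hF : IsCharFamily N F) (hS : IsFiniteSymmGenSet S) :
    MetricSpace G where
  dist x y := charNatDist S F x y
  dist_self x := by
    have : charNatDist S F x x ≤ 0 := charNatDist_le_iff.2 (by simp)
    exact_mod_cast Nat.le_zero.1 this
  dist_comm x y := by rw [hF.charNatDist_comm]
  dist_triangle x y z := by
    have : charNatDist S F x z ≤ charNatDist S F x y + charNatDist S F y z := by
      refine charNatDist_le_iff.2 ⟨?_, fun f hf => ?_⟩
      · exact hS.connected.dist_triangle.trans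
          (add_le_add (dist_le_charNatDist ..) (dist_le_charNatDist ..))
      · have h1 := sub_le_charNatDist S hf x y
        have h2 := sub_le_charNatDist S hf y z
        push_cast
        linarith
    exact_mod_cast this
  eq_of_dist_eq_zero {x y} h := by
    have h0 : charNatDist S F x y = 0 := by exact_mod_cast h
    have := dist_le_charNatDist S F x y
    exact hS.connected.dist_eq_zero_iff.1 (by omega)

theorem metric_dist (hF : IsCharFamily N F) (hS : IsFiniteSymmGenSet S) (x y : G) :
    (hF.metric hS).dist x y = charNatDist S F x y := rfl

/-- The members of `F` are uniformly Lipschitz for the word metric: by invariance it is enough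
to bound them on the generators. -/
theorem exists_lipschitz (hF : IsCharFamily N F) (hS : IsFiniteSymmGenSet S) :
    ∃ L : ℕ, ∀ f ∈ F, ∀ x y, f x - f y ≤ L * (SimpleGraph.mulCayley S).dist x y := by
  have hfin : ((fun p : (G → ℤ) × G => p.1 p.2) '' ((F : Set (G → ℤ)) ×ˢ S)).Finite :=
    (F.finite_toSet.prod hS.finite).image _
  obtain ⟨K, hK⟩ := hfin.bddAbove
  have hgen : ∀ f ∈ F, ∀ s ∈ S, f s ≤ K.toNat := fun f hf s hs =>
    (hK ⟨(f, s), ⟨hf, hs⟩, rfl⟩).trans (Int.self_le_toNat K)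
  have hstep : ∀ f ∈ F, ∀ x y, (SimpleGraph.mulCayley S).Adj x y → f x - f y ≤ K.toNat := by
    intro f hf x y hxy
    have hs : y⁻¹ * x ∈ S := by
      obtain ⟨-, h | h⟩ := (SimpleGraph.mulCayley_adj S _ _).1 hxy
      · simpa using hS.symm _ h
      · exact h
    simpa using hgen _ (hF.translate_mem f hf y⁻¹) _ hs
  refine ⟨K.toNat, fun f hf x y => ?_⟩
  obtain ⟨p, hp⟩ := hS.connected.exists_walk_length_eq_dist x y
  rw [← hp]
  clear hp
  induction p with
  | nil => simp
  | cons h p ih =>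
    have := hstep f hf _ _ h
    rw [SimpleGraph.Walk.length_cons]
    push_cast at this ih ⊢
    linarith

/-- Far from `1`, a Busemann function is large on one of finitely many points. Either some
`f ∈ F` nearly realizes the distance `d(x,1)`, and then a point where `f` is very negative will do,
or all `f x` are so much smaller than `d(x,1)` that on a ball of radius `R` they do not matter,
and then the point at distance `R` on a geodesic of the word metric from `1` to `x` will do. -/
theorem exists_le_abs_busemann (hF : IsCharFamily N F) (hS : IsFiniteSymmGenSet S) (R : ℕ) :
    ∃ A B : Set G, A.Finite ∧ B.Finite ∧
      ∀ x ∉ B, ∃ y ∈ A, (R : ℝ) ≤ |busemann (hF.metric hS) 1 x y| := by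
  obtain ⟨L, hL⟩ := hF.exists_lipschitz hS
  have hy : ∀ f : F, ∃ y, f.1 y ≤ -((L + 1) * R + R : ℤ) := fun f => hF.exists_lt f.2 _
  choose y hy using hy
  refine ⟨Set.range y ∪ {x : G | (SimpleGraph.mulCayley S).dist x 1 ≤ R},
    {x : G | (SimpleGraph.mulCayley S).dist x 1 ≤ R},
    (Set.finite_range y).union (hS.finite_ball R), hS.finite_ball R, fun x hx => ?_⟩
  rw [Set.mem_ofPred_eq, not_le] at hx
  by_cases hcase : ∃ f ∈ F, (charNatDist S F x 1 : ℤ) - (L + 1) * R ≤ f x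
  · obtain ⟨f, hf, hfx⟩ := hcase
    refine ⟨y ⟨f, hf⟩, Or.inl ⟨_, rfl⟩, le_trans ?_ (le_abs_self _)⟩
    have h1 := sub_le_charNatDist S hf x (y ⟨f, hf⟩)
    have h2 := hy ⟨f, hf⟩
    simp only at h2
    have h3 : (R : ℤ) ≤ charNatDist S F x (y ⟨f, hf⟩) - charNatDist S F x 1 := by linarith
    simp only [busemann, metric_dist]
    exact_mod_cast h3
  · push Not at hcase
    obtain ⟨z, hz1, hzx⟩ := hS.connected.exists_dist_le_and_dist_le 1 x R
    rw [SimpleGraph.dist_comm] at hz1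
    rw [SimpleGraph.dist_comm, SimpleGraph.dist_comm (u := 1)] at hzx
    refine ⟨z, Or.inr hz1, le_trans ?_ (neg_le_abs _)⟩
    have hd := dist_le_charNatDist S F x 1
    have h1 : charNatDist S F x z ≤ charNatDist S F x 1 - R := by
      refine charNatDist_le_iff.2 ⟨by omega, fun f hf => ?_⟩
      have h2 := hcase f hf
      have h3 := hL f hf 1 z
      rw [SimpleGraph.dist_comm, hF.map_one hf] at h3
      have h4 : (L : ℤ) * (SimpleGraph.mulCayley S).dist z 1 ≤ L * R := by gcongr
      push_cast [show R ≤ charNatDist S F x 1 by omega]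
      linarith
    have h5 : (R : ℤ) ≤ -((charNatDist S F x z : ℤ) - charNatDist S F x 1) := by omega
    simp only [busemann, metric_dist]
    exact_mod_cast h5

theorem infinite (hF : IsCharFamily N F) : Infinite G := by
  obtain ⟨f, hf⟩ := hF.nonempty
  by_contra hfin
  rw [not_infinite_iff_finite] at hfin
  obtain ⟨K, hK⟩ := (Set.finite_range f).bddBelow
  obtain ⟨y, hy⟩ := hF.exists_lt hf (K - 1)
  have := hK ⟨y, rfl⟩
  omega

theorem isBanachMetric (hF : IsCharFamily N F) (hS : IsFiniteSymmGenSet S) :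
    IsBanachMetric (hF.metric hS) where
  infinite := hF.infinite
  integer_valued x y := ⟨_, rfl⟩
  left_invariant x y z := by simp only [metric_dist, hF.charNatDist_mul_left]
  proper r _ := by
    obtain ⟨n, hn⟩ := exists_nat_ge r
    refine (hS.finite_ball n).subset fun x hx => ?_
    have h1 : (charNatDist S F x 1 : ℝ) ≤ n := le_trans hx hn
    exact (dist_le_charNatDist S F x 1).trans (by exact_mod_cast h1)
  quasiIsometric := by
    obtain ⟨L, hL⟩ := hF.exists_lipschitz hS
    refine ⟨S, hS, id, L + 1, by positivity, fun y => ⟨y, ?_⟩, fun x y => ⟨?_, ?_⟩⟩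
    · simp only [cayleyDist, id, SimpleGraph.dist_self, Nat.cast_zero]
      positivity
    · have h1 : charNatDist S F x y ≤ (L + 1) * (SimpleGraph.mulCayley S).dist x y := by
        refine charNatDist_le_iff.2 ⟨Nat.le_mul_of_pos_left _ (by omega), fun f hf => ?_⟩
        have := hL f hf x y
        push_cast
        linarith [Int.natCast_nonneg ((SimpleGraph.mulCayley S).dist x y)]
      have h2 : (charNatDist S F x y : ℝ) ≤ (L + 1) * (SimpleGraph.mulCayley S).dist x y := by
        exact_mod_cast h1
      have h3 : ((L : ℝ) + 1)⁻¹ * charNatDist S F x y ≤ (SimpleGraph.mulCayley S).dist x y := by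
        rw [inv_mul_le_iff₀ (by positivity)]
        exact h2
      simp only [metric_dist, cayleyDist, id]
      linarith [Nat.cast_nonneg (α := ℝ) L]
    · have h1 : ((SimpleGraph.mulCayley S).dist x y : ℝ) ≤ charNatDist S F x y := by
        exact_mod_cast dist_le_charNatDist S F x y
      simp only [metric_dist, cayleyDist, id]
      have h2 : (0 : ℝ) ≤ L := Nat.cast_nonneg L
      have h3 : (0 : ℝ) ≤ charNatDist S F x y := Nat.cast_nonneg _
      nlinarith
  unbounded _ hh := not_bounded_of_mem_boundary (hF.exists_le_abs_busemann hS) hh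

/-! ### A functional fixed by a subgroup of finite index -/

/-- If `t ∈ S` is generic, the Busemann functions of `t ^ n` converge to
`h(y) = - min f(y)`, the minimum being over the members `f` of `F` with maximal `f t`. -/
theorem exists_mem_boundary (hF : IsCharFamily N F) (hS : IsFiniteSymmGenSet S) {t : G}
    (ht : t ∈ N) (htS : t ∈ S) (hgen : ∀ f ∈ F, ∀ g ∈ F, f t = g t → ∀ n ∈ N, f n = g n)
    (ht2 : ∃ f ∈ F, 2 ≤ f t) :
    ∃ h ∈ boundary (hF.metric hS) (1 : G), ∀ x ∈ N, translate x h = h := by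
  obtain ⟨f₀, hf₀, hmax⟩ := F.exists_max_image (fun f => f t) hF.nonempty
  have hf₀2 : 2 ≤ f₀ t := by
    obtain ⟨f, hf, h2⟩ := ht2
    exact h2.trans (hmax f hf)
  let M : Finset (G → ℤ) := F.filter fun f => f t = f₀ t
  have hM : M.Nonempty := ⟨f₀, by simp [M, hf₀]⟩
  let H : G → ℤ := fun y => M.sup' hM fun f => -f y
  have hHN : ∀ n ∈ N, ∀ y, H (n * y) = H y - f₀ n := fun n hn y => by
    have key : ∀ f ∈ M, -f (n * y) = -f y - f₀ n := fun f hf => by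
      obtain ⟨hfF, hft⟩ := Finset.mem_filter.1 hf
      rw [hF.map_mul f hfF n hn, hgen f hfF f₀ hf₀ hft n hn]
      ring
    apply le_antisymm
    · refine Finset.sup'_le _ _ fun f hf => ?_
      rw [key f hf]
      linarith [Finset.le_sup' (fun f : G → ℤ => -f y) hf]
    · rw [sub_le_iff_le_add]
      refine Finset.sup'_le _ _ fun f hf => ?_
      have h1 := Finset.le_sup' (fun f : G → ℤ => -f (n * y)) hf
      simp only [key f hf] at h1
      simp only [H]
      linarith
  have hH1 : H 1 = 0 := by
    apply le_antisymm
    · refine Finset.sup'_le _ _ fun f hf => ?_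
      rw [hF.map_one (Finset.mem_filter.1 hf).1, neg_zero]
    · have h1 := Finset.le_sup' (fun f : G → ℤ => -f 1) hM.choose_spec
      simp only [hF.map_one (Finset.mem_filter.1 hM.choose_spec).1, neg_zero] at h1
      exact h1
  have htn : ∀ n : ℕ, (SimpleGraph.mulCayley S).dist (t ^ n) 1 ≤ n := fun n => by
    induction n with
    | zero => simp
    | succ n ih =>
      have h1 : (SimpleGraph.mulCayley S).dist (t ^ (n + 1)) (t ^ n) ≤ 1 := by
        by_cases h : t ^ (n + 1) = t ^ n
        · simp [h]
        · refine (SimpleGraph.dist_eq_one_iff_adj.2 ?_).le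
          exact (SimpleGraph.mulCayley_adj S _ _).2 ⟨h, Or.inr (by simpa [pow_succ] using htS)⟩
      have h2 := hS.connected.dist_triangle (u := t ^ (n + 1)) (v := t ^ n) (w := 1)
      omega
  -- The word metric grows at rate at most `1` along `t ^ n`, and the members of `F` outside `M`
  -- at rate at most `f₀ t - 1`, so eventually only the members of `M` contribute.
  have hdist : ∀ y, ∃ n₀ : ℕ, ∀ n ≥ n₀, (charNatDist S F (t ^ n) y : ℤ) = n * f₀ t + H y := by
    intro y
    obtain ⟨K, hK⟩ := ((F.image fun f => -f y) : Finset ℤ).bddAbove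
    have hK' : ∀ f ∈ F, -f y ≤ K := fun f hf =>
      hK (Finset.mem_coe.2 (Finset.mem_image_of_mem _ hf))
    refine ⟨(SimpleGraph.mulCayley S).dist 1 y + (H y).natAbs + K.natAbs, fun n hn => ?_⟩
    have hlow : (n : ℤ) * f₀ t + H y ≤ charNatDist S F (t ^ n) y := by
      have h1 : H y ≤ charNatDist S F (t ^ n) y - n * f₀ t := by
        refine Finset.sup'_le _ _ fun f hf => ?_
        obtain ⟨hfF, hft⟩ := Finset.mem_filter.1 hf
        have h2 := sub_le_charNatDist S hfF (t ^ n) y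
        rw [hF.map_pow hfF ht, hft] at h2
        linarith
      linarith
    have hn2 : (n : ℤ) * 2 ≤ n * f₀ t := by gcongr
    refine le_antisymm ?_ hlow
    have hnonneg : 0 ≤ (n : ℤ) * f₀ t + H y := by omega
    obtain ⟨m, hm⟩ := Int.eq_ofNat_of_zero_le hnonneg
    rw [hm]
    refine Int.ofNat_le.2 (charNatDist_le_iff.2 ⟨?_, fun f hf => ?_⟩)
    · have h1 := htn n
      have h2 := hS.connected.dist_triangle (u := t ^ n) (v := 1) (w := y)
      omega
    · rw [← hm, hF.map_pow hf ht]
      by_cases hft : f t = f₀ t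
      · have h1 := Finset.le_sup' (fun f : G → ℤ => -f y) (Finset.mem_filter.2 ⟨hf, hft⟩ : f ∈ M)
        rw [hft]
        simp only [H]
        linarith
      · have h1 : f t ≤ f₀ t - 1 := by have := hmax f hf; omega
        have h2 : (n : ℤ) * f t ≤ n * (f₀ t - 1) := by gcongr
        have h3 := hK' f hf
        have h4 : (n : ℤ) * (f₀ t - 1) = n * f₀ t - n := by ring
        omega
  refine ⟨fun y => H y, ⟨?_, ?_⟩, fun x hx => ?_⟩
  · refine mem_closure_of_tendsto (f := fun n : ℕ => busemann (hF.metric hS) 1 (t ^ n))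
      (b := Filter.atTop) (tendsto_pi_nhds.2 fun y => ?_)
      (Filter.Eventually.of_forall fun n => ⟨_, rfl⟩)
    obtain ⟨n₁, hn₁⟩ := hdist y
    obtain ⟨n₂, hn₂⟩ := hdist 1
    refine tendsto_const_nhds.congr' ?_
    filter_upwards [Filter.eventually_ge_atTop n₁, Filter.eventually_ge_atTop n₂] with n h1 h2
    have h3 : H y = (charNatDist S F (t ^ n) y : ℤ) - charNatDist S F (t ^ n) 1 := by
      rw [hn₁ n h1, hn₂ n h2, hH1]
      ring
    simp only [busemann, metric_dist, h3]
    push_cast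
    ring
  · -- Busemann functions are bounded below, but `H (t ^ n) = - n * f₀ t`.
    rintro ⟨x, hx⟩
    have h1 := congrFun hx (t ^ (charNatDist S F x 1 + 1))
    simp only [busemann, metric_dist] at h1
    have h2 := hHN _ (pow_mem ht (charNatDist S F x 1 + 1)) 1
    rw [mul_one, hH1, hF.map_pow hf₀ ht] at h2
    rw [h2] at h1
    have h3 : (charNatDist S F x (t ^ (charNatDist S F x 1 + 1)) : ℤ) - charNatDist S F x 1 =
        0 - ((charNatDist S F x 1 + 1 : ℕ) : ℤ) * f₀ t := by exact_mod_cast h1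
    push_cast at h3
    nlinarith
  · funext y
    have h1 := hHN x⁻¹ (inv_mem hx) y
    have h2 := hHN x⁻¹ (inv_mem hx) 1
    rw [mul_one, hH1] at h2
    simp only [translate, h1, h2]
    push_cast
    ring

end IsCharFamily

theorem exists_isFiniteSymmGenSet_mem [Group.FG G] (t : G) :
    ∃ S : Set G, IsFiniteSymmGenSet S ∧ t ∈ S := by
  obtain ⟨S, hS, hfin⟩ := (Group.fg_iff (G := G)).1 inferInstance
  refine ⟨insert t S ∪ (insert t S)⁻¹, ⟨(hfin.insert t).union (hfin.insert t).inv, ?_, ?_⟩,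
    Or.inl (Or.inl rfl)⟩
  · rintro s (h | h)
    · exact Or.inr (by simpa using h)
    · exact Or.inl h
  · exact top_le_iff.1 (hS.ge.trans (Subgroup.closure_mono
      ((Set.subset_insert t S).trans Set.subset_union_left)))

theorem exists_isBanachMetric_fixed [Group.FG G] {N : Subgroup G} [N.Normal] [N.FiniteIndex]
    {φ : G → ℤ} (hφ : ∀ x ∈ N, ∀ y ∈ N, φ (x * y) = φ x + φ y) (hne : ∃ x ∈ N, φ x ≠ 0) :
    ∃ d : MetricSpace G, IsBanachMetric d ∧
      ∃ h ∈ boundary d (1 : G), ∀ x ∈ N, translate x h = h := by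
  obtain ⟨F, hF⟩ := exists_isCharFamily hφ hne
  obtain ⟨t, ht, hgen, ht2⟩ := hF.exists_generic
  obtain ⟨S, hS, htS⟩ := exists_isFiniteSymmGenSet_mem t
  exact ⟨hF.metric hS, hF.isBanachMetric hS, hF.exists_mem_boundary hS ht htS hgen ht2⟩

theorem finite_functionalOrbit {N : Subgroup G} [N.FiniteIndex] {h : G → ℝ}
    (hN : ∀ x ∈ N, translate x h = h) : (functionalOrbit h).Finite := by
  have hcoset : ∀ x, ∀ n ∈ N, translate (x * n) h = translate x h := fun x n hn => by
    funext y
    have h1 := congrFun (hN n hn) (x⁻¹ * y)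
    have h2 := congrFun (hN n hn) x⁻¹
    simp only [translate, mul_inv_rev, mul_assoc] at h1 h2 ⊢
    linarith
  exact finite_range_of_mul_right hcoset

/-- A virtual homomorphism remains non-trivial on the normal core, since `ℤ` is torsion-free. -/
theorem IsVirtualHom.exists_normal {φ : G → ℤ} (hφ : IsVirtualHom φ) :
    ∃ N : Subgroup G, N.Normal ∧ N.FiniteIndex ∧
      (∀ x ∈ N, ∀ y ∈ N, φ (x * y) = φ x + φ y) ∧ ∃ x ∈ N, φ x ≠ 0 := by
  obtain ⟨H, hH, hmul, x, hx, hx0⟩ := hφ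
  refine ⟨H.normalCore, inferInstance, inferInstance,
    fun a ha b hb => hmul a (H.normalCore_le ha) b (H.normalCore_le hb), ?_⟩
  obtain ⟨n, hn, -, hxn⟩ :=
    Subgroup.exists_pow_mem_of_index_ne_zero (H := H.normalCore) Subgroup.FiniteIndex.index_ne_zero x
  refine ⟨x ^ n, hxn, ?_⟩
  have h1 : φ 1 = 0 := by
    have := hmul 1 H.one_mem 1 H.one_mem
    simpa using this
  have hpow : ∀ k : ℕ, φ (x ^ k) = k * φ x := fun k => by
    induction k with
    | zero => simp [h1]
    | succ k ih =>
      rw [pow_succ, hmul _ (pow_mem hx k) x hx, ih]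
      push_cast
      ring
  rw [hpow]
  exact mul_ne_zero (by exact_mod_cast hn.ne') hx0

end BanachMetrics

theorem theorem2p5 {G : Type*} [Group G] [Group.FG G] :
    ((∃ φ : G → ℤ, BanachMetrics.IsVirtualHom φ) ↔
      ∃ d : MetricSpace G, BanachMetrics.IsBanachMetric d ∧
        ∃ h ∈ BanachMetrics.boundary d (1 : G), (BanachMetrics.functionalOrbit h).Finite) ∧
    ((∃ f : G →* Multiplicative ℤ, Function.Surjective f) →
      ∃ d : MetricSpace G, BanachMetrics.IsBanachMetric d ∧
        ∃ h ∈ BanachMetrics.boundary d (1 : G), ∀ x : G, BanachMetrics.translate x h = h) := by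
  refine ⟨⟨?_, ?_⟩, ?_⟩
  · rintro ⟨φ, hφ⟩
    obtain ⟨N, hN, hNfi, hmul, hne⟩ := hφ.exists_normal
    obtain ⟨d, hd, h, hh, hfix⟩ := BanachMetrics.exists_isBanachMetric_fixed hmul hne
    exact ⟨d, hd, h, hh, BanachMetrics.finite_functionalOrbit hfix⟩
  · rintro ⟨d, hd, h, hh, hfin⟩
    exact BanachMetrics.exists_isVirtualHom hd hh hfin
  · rintro ⟨f, hf⟩
    obtain ⟨x, hx⟩ := hf (Multiplicative.ofAdd 1)
    obtain ⟨d, hd, h, hh, hfix⟩ := BanachMetrics.exists_isBanachMetric_fixed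
      (N := (⊤ : Subgroup G)) (φ := fun x => (f x).toAdd) (by simp)
      ⟨x, trivial, by simp [hx]⟩
    exact ⟨d, hd, h, hh, fun x => hfix x trivial⟩
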